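/- A class of groups $\mathscr{G}$ is closed under isomorphisms if every group isomorphic to a member of $\mathscr{G}$ lies in $\mathscr{G}$, and closed under finitely generated subgroups if every finitely generated subgroup of a member of $\mathscr{G}$ lies in $\mathscr{G}$. A subset $U$ of a topological space $T$ is a $\mathscr{G}$-set if for every $x \in U$ the image of the homomorphism $\pi_1(U,x) \to \pi_1(T,x)$ induced by the inclusion lies in $\mathscr{G}$. The $\mathscr{G}$-category $\operatorname{cat}_{\mathscr{G}}(T)$ is the minimal $n \in \mathbb{N} = \{0,1,\dots\}$ such that $T$ has an open cover consisting of exactly $n$ $\mathscr{G}$-sets, and $+\infty$ if no such $n$ exists. For $k \in \mathbb{N}$, a finite simplicial complex $X$ satisfies the fibre collapsing assumption with respect to $\mathscr{G}$ in dimension $k$ if there is a simplicial map $f \colon X \to P$ to a finite simplicial complex $P$ with $\dim P \leq k$ such that for every point $p$ of (the geometric realisation of) $P$, not necessarily a vertex, the fibre $f^{-1}(p)$ is a $\mathscr{G}$-set in (the geometric realisation of) $X$. **Proposition.** Let $\mathscr{G}$ be a class of groups that is closed under isomorphisms, let $X$ be a finite simplicial complex, and let $k \in \mathbb{N}$. Then: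 1. If $X$ satisfies the fibre collapsing assumption with respect to $\mathscr{G}$ in dimension $k$, then $\operatorname{cat}_{\mathscr{G}}(X) \leq k+1$. 2. If in addition $\mathscr{G}$ is closed under finitely generated subgroups and if $\operatorname{cat}_{\mathscr{G}}(X) \leq k+1$, then there exists an iterated barycentric subdivision of $X$ that satisfies the fibre collapsing assumption with respect to $\mathscr{G}$ in dimension $k$. -/

import Mathlib

universe u

/-- A class of groups. -/
abbrev GroupClass : Type (u + 1) := ∀ (G : Type u) [Group G], Prop

namespace GroupClass

def ClosedUnderIso (𝒢 : GroupClass.{u}) : Prop :=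
  ∀ (G H : Type u) [Group G] [Group H], Nonempty (G ≃* H) → 𝒢 G → 𝒢 H

def ClosedUnderFGSubgroups (𝒢 : GroupClass.{u}) : Prop :=
  ∀ (G : Type u) [Group G] (H : Subgroup G), H.FG → 𝒢 G → 𝒢 H

/-- `U ⊆ T` is a `𝒢`-set if, for every `x ∈ U`, the image of `π₁(U, x) → π₁(T, x)` is in `𝒢`. -/
def IsGSet (𝒢 : GroupClass.{u}) {T : Type u} [TopologicalSpace T] (U : Set T) : Prop :=
  ∀ x : U, 𝒢 (FundamentalGroup.map (⟨Subtype.val, continuous_subtype_val⟩ : C(U, T)) x).range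

/-- An open cover of `T` by `𝒢`-sets. -/
def IsOpenGCover (𝒢 : GroupClass.{u}) {T : Type u} [TopologicalSpace T]
    (𝒰 : Set (Set T)) : Prop :=
  (∀ U ∈ 𝒰, IsOpen U ∧ 𝒢.IsGSet U) ∧ ⋃₀ 𝒰 = Set.univ

/-- The minimal `n : ℕ` such that `T` has an open `𝒢`-cover of cardinality `n`;
`⊤` if there is no such `n`. -/
noncomputable def cat (𝒢 : GroupClass.{u}) (T : Type u) [TopologicalSpace T] : ℕ∞ :=
  ⨅ (n : ℕ) (_ : ∃ 𝒰 : Set (Set T), 𝒢.IsOpenGCover 𝒰 ∧ 𝒰.encard = n), (n : ℕ∞)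

end GroupClass

/-- A finite (abstract) simplicial complex. -/
structure FinSimplicialComplex : Type (u + 1) where
  V : Type u
  [fintypeV : Fintype V]
  complex : AbstractSimplicialComplex V

attribute [instance] FinSimplicialComplex.fintypeV

namespace FinSimplicialComplex

/-- `dim X ≤ k`. The empty complex has dimension `-1`. -/
def DimLE (X : FinSimplicialComplex.{u}) (k : ℕ) : Prop :=
  ∀ s ∈ X.complex.faces, s.card ≤ k + 1

/-- The geometric realisation, in barycentric coordinates: the points of the standard simplex on
the vertices whose support lies in a face. It carries the subspace topology of `X.V → ℝ`. -/
def realization (X : FinSimplicialComplex.{u}) : Set (X.V → ℝ) :=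
  {x | x ∈ stdSimplex ℝ X.V ∧ ∃ s ∈ X.complex.faces, ∀ v, x v ≠ 0 → v ∈ s}

open Classical in
/-- A simplicial map: a map of vertices that maps faces to faces. -/
structure SimplicialMap (X P : FinSimplicialComplex.{u}) where
  toFun : X.V → P.V
  image_mem : ∀ s ∈ X.complex.faces, s.image toFun ∈ P.complex.faces

open Classical in
/-- The map of geometric realisations that is affine on each simplex and extends the given map
of vertices. -/
noncomputable def SimplicialMap.realize {X P : FinSimplicialComplex.{u}} (f : SimplicialMap X P)
    (x : X.realization) : P.realization :=
  ⟨fun w => ∑ v with f.toFun v = w, x.1 v, by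
    obtain ⟨x, ⟨h0, h1⟩, s, hs, hx⟩ := x
    refine ⟨⟨fun w => Finset.sum_nonneg fun v _ => h0 v, ?_⟩, _, f.image_mem s hs, ?_⟩
    · exact (Finset.sum_fiberwise _ _ _).trans h1
    · intro w hw
      obtain ⟨v, hv, hv0⟩ := Finset.exists_ne_zero_of_sum_ne_zero hw
      exact Finset.mem_image.2 ⟨v, hx v hv0, (Finset.mem_filter.1 hv).2⟩⟩

/-- The barycentric subdivision: the vertices are the faces of `X`, the faces are the non-empty
chains of faces of `X` with respect to inclusion. -/
noncomputable def barycentricSubdivision (X : FinSimplicialComplex.{u}) :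
    FinSimplicialComplex.{u} where
  V := {s : Finset X.V // s ∈ X.complex.faces}
  fintypeV := Fintype.ofFinite _
  complex :=
    { faces := {c | c.Nonempty ∧ ∀ s ∈ c, ∀ t ∈ c, s.1 ⊆ t.1 ∨ t.1 ⊆ s.1}
      isRelLowerSet_faces := fun _ hc =>
        ⟨hc.1, fun _ hdc hd => ⟨hd, fun s hs t ht => hc.2 s (hdc hs) t (hdc ht)⟩⟩
      singleton_mem := fun s => ⟨Finset.singleton_nonempty s, by
        intro a ha b hb
        rw [Finset.mem_singleton.1 ha, Finset.mem_singleton.1 hb]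
        exact Or.inl (Finset.Subset.refl _)⟩ }

/-- The fibre collapsing assumption with respect to `𝒢` in dimension `k`. -/
def FCA (X : FinSimplicialComplex.{u}) (𝒢 : GroupClass.{u}) (k : ℕ) : Prop :=
  ∃ (P : FinSimplicialComplex.{u}) (f : SimplicialMap X P), P.DimLE k ∧
    ∀ p : P.realization, 𝒢.IsGSet (f.realize ⁻¹' {p})

end FinSimplicialComplex

/-! For the first claim, pull back along `f` the open stars of the barycentres of the faces of `P`.
Two such stars meet only if the faces are nested, so the stars of all faces with `i` vertices are
disjoint, and a loop in their union stays in one of them. The preimage of a star moves along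
straight lines of `X`, without leaving that preimage, into the fibre over the barycentre
(`fibreRetraction`). Hence its loops give, up to conjugation, the same subgroup as the fibre. The
values `i = 1, ..., k + 1` cover `X` (`isGSet_levelSet`).

For the second claim, take a cover by at most `k + 1` `𝒢`-sets and a Lebesgue number, and subdivide
until each open star maps into a member (`exists_hasFineMap`). Choosing such a member for each
vertex gives a simplicial map to the full simplex on the cover. Each of its fibres maps into one
member `U`. Three facts finish the proof: the map from the subdivision to `X` is injective on `π₁`
(`map_subdivisionMap_injective`), so the image of `π₁` of a fibre embeds into that of `U`; a fibre
is closed and convex in every simplex, so this image is finitely generated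
(`loopSubgroup_fg_of_convex`); and `𝒢` is closed under finitely generated subgroups. -/

section

open CategoryTheory Set
open scoped unitInterval

/-! ### Arrows of the fundamental groupoid carried by a subset -/

namespace FundamentalGroupoid

variable {T : Type u} [TopologicalSpace T]

/-- The arrow `q` of the fundamental groupoid is represented by a path inside `U`. -/
def InSet (U : Set T) {a b : T} (q : FundamentalGroupoid.mk a ⟶ FundamentalGroupoid.mk b) : Prop :=
  ∃ γ : Path a b, (∀ t, γ t ∈ U) ∧ q = Path.Homotopic.Quotient.mk γ

theorem InSet.mono {U U' : Set T} (h : U ⊆ U') {a b : T}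
    {q : FundamentalGroupoid.mk a ⟶ FundamentalGroupoid.mk b} : InSet U q → InSet U' q :=
  fun ⟨γ, hγ, e⟩ => ⟨γ, fun t => h (hγ t), e⟩

theorem InSet.id {U : Set T} {a : T} (ha : a ∈ U) : InSet U (𝟙 (FundamentalGroupoid.mk a)) :=
  ⟨Path.refl a, fun _ => ha, rfl⟩

theorem InSet.comp {U : Set T} {a b c : T}
    {p : FundamentalGroupoid.mk a ⟶ FundamentalGroupoid.mk b}
    {q : FundamentalGroupoid.mk b ⟶ FundamentalGroupoid.mk c}
    (hp : InSet U p) (hq : InSet U q) : InSet U (p ≫ q) := by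
  obtain ⟨γ, hγ, rfl⟩ := hp
  obtain ⟨δ, hδ, rfl⟩ := hq
  refine ⟨γ.trans δ, fun t => ?_, rfl⟩
  have : γ.trans δ t ∈ range (γ.trans δ) := ⟨t, rfl⟩
  rw [Path.trans_range] at this
  rcases this with ⟨s, hs⟩ | ⟨s, hs⟩
  · exact hs ▸ hγ s
  · exact hs ▸ hδ s

theorem InSet.inv {U : Set T} {a b : T}
    {p : FundamentalGroupoid.mk a ⟶ FundamentalGroupoid.mk b} (hp : InSet U p) :
    InSet U (Groupoid.inv p) := by
  obtain ⟨γ, hγ, rfl⟩ := hp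
  exact ⟨γ.symm, fun t => hγ _, rfl⟩

theorem InSet.source_mem {U : Set T} {a b : T}
    {p : FundamentalGroupoid.mk a ⟶ FundamentalGroupoid.mk b} (hp : InSet U p) : a ∈ U := by
  obtain ⟨γ, hγ, rfl⟩ := hp
  simpa using hγ 0

theorem InSet.target_mem {U : Set T} {a b : T}
    {p : FundamentalGroupoid.mk a ⟶ FundamentalGroupoid.mk b} (hp : InSet U p) : b ∈ U := by
  obtain ⟨γ, hγ, rfl⟩ := hp
  simpa using hγ 1

/-- The loops at `a` represented by loops inside `U`. -/
def loopSubgroup (U : Set T) (a : T) (ha : a ∈ U) : Subgroup (FundamentalGroup T a) where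
  carrier := {q | InSet U q}
  mul_mem' hp hq := hq.comp hp
  one_mem' := InSet.id ha
  inv_mem' hp := hp.inv

theorem mem_loopSubgroup {U : Set T} {a : T} {ha : a ∈ U} {q : FundamentalGroup T a} :
    q ∈ loopSubgroup U a ha ↔ InSet U q := Iff.rfl

theorem range_map_eq_loopSubgroup (U : Set T) (x : U) :
    (FundamentalGroup.map (⟨Subtype.val, continuous_subtype_val⟩ : C(U, T)) x).range =
      loopSubgroup U x.1 x.2 := by
  ext q
  constructor
  · rintro ⟨p, rfl⟩
    obtain ⟨γ, rfl⟩ := Path.Homotopic.Quotient.mk_surjective p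
    exact ⟨γ.map continuous_subtype_val, fun t => (γ t).2, rfl⟩
  · rintro ⟨γ, hγ, rfl⟩
    let γ' : Path x x :=
      { toFun := fun t => ⟨γ t, hγ t⟩
        continuous_toFun := by fun_prop
        source' := Subtype.ext γ.source
        target' := Subtype.ext γ.target }
    exact ⟨Path.Homotopic.Quotient.mk γ', rfl⟩

/-- Conjugation by an arrow between subgroups of vertex groups. -/
theorem nonempty_mulEquiv_of_conj {a b : T} (d : FundamentalGroupoid.mk a ⟶ .mk b)
    (L : Subgroup (FundamentalGroup T a)) (L' : Subgroup (FundamentalGroup T b))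
    (h : ∀ q ∈ L, Groupoid.inv d ≫ q ≫ d ∈ L') (h' : ∀ q ∈ L', d ≫ q ≫ Groupoid.inv d ∈ L) :
    Nonempty (L' ≃* L) :=
  ⟨{ toFun := fun q => ⟨d ≫ q.1 ≫ Groupoid.inv d, h' _ q.2⟩
     invFun := fun q => ⟨Groupoid.inv d ≫ q.1 ≫ d, h _ q.2⟩
     left_inv := fun q => Subtype.ext (by simp)
     right_inv := fun q => Subtype.ext (by simp)
     map_mul' := fun p q => Subtype.ext (by
      show d ≫ (q.1 ≫ p.1) ≫ _ = (d ≫ q.1 ≫ _) ≫ (d ≫ p.1 ≫ _)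
      simp) }⟩

theorem mk_comp_evalAt {Y : Type*} [TopologicalSpace Y] {f g : C(Y, T)} (F : f.Homotopy g)
    {a b : Y} (γ : Path a b) :
    (FundamentalGroupoid.fromPath (.mk (γ.map f.continuous)) ≫
      FundamentalGroupoid.fromPath (.mk (F.evalAt b)) : FundamentalGroupoid.mk (f a) ⟶ .mk (g b)) =
    FundamentalGroupoid.fromPath (.mk (F.evalAt a)) ≫
      FundamentalGroupoid.fromPath (.mk (γ.map g.continuous)) :=
  Path.Homotopic.Quotient.eq.2 (Path.Homotopic.map_trans_evalAt F γ)

/-- By naturality of `F`, going around through `h` and `g` is conjugation by the track of `x`, which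
is injective. Only a one-sided homotopy inverse is needed. -/
theorem map_injective_of_homotopy {Y : Type*} [TopologicalSpace Y] (h : C(T, Y)) (g : C(Y, T))
    (F : (ContinuousMap.id T).Homotopy (g.comp h)) (x : T) :
    Function.Injective (FundamentalGroup.map h x) := by
  intro p q hpq
  obtain ⟨γ, rfl⟩ := Path.Homotopic.Quotient.mk_surjective p
  obtain ⟨δ, rfl⟩ := Path.Homotopic.Quotient.mk_surjective q
  have h1 := mk_comp_evalAt F γ
  have h2 := mk_comp_evalAt F δ
  have h3 : (Path.Homotopic.Quotient.mk (γ.map (g.comp h).continuous)) =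
      .mk (δ.map (g.comp h).continuous) :=
    congrArg (fun r : Path.Homotopic.Quotient (h x) (h x) => r.map g) hpq
  rw [h3, ← h2] at h1
  exact (cancel_mono _).1 h1

theorem InSet.map {Y : Type*} [TopologicalSpace Y] (h : C(T, Y)) {U : Set T} {U' : Set Y}
    (hU : MapsTo h U U') {a b : T} {q : FundamentalGroupoid.mk a ⟶ .mk b} (hq : InSet U q) :
    InSet U' ((FundamentalGroupoid.map h).map q) := by
  obtain ⟨γ, hγ, rfl⟩ := hq
  exact ⟨γ.map h.continuous, fun t => hU (hγ t), rfl⟩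

/-- A property of arrows that is stable under composition and holds for the arrows
represented in one member of a relatively open cover of `K` holds for all arrows in `K`. -/
theorem InSet.induction {ι : Type*} {K : Set T} {O : ι → Set T} (hO : ∀ i, IsOpen (O i))
    (hK : K ⊆ ⋃ i, O i)
    (P : ∀ a b : T, (FundamentalGroupoid.mk a ⟶ FundamentalGroupoid.mk b) → Prop)
    (small : ∀ i a b q, InSet (O i ∩ K) q → P a b q)
    (comp : ∀ a b c p q, P a b p → P b c q → P a c (p ≫ q))
    {a b : T} {q : FundamentalGroupoid.mk a ⟶ .mk b} (hq : InSet K q) : P a b q := by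
  obtain ⟨γ, hγ, rfl⟩ := hq
  obtain ⟨t, ht0, htm, ⟨n, hn⟩, ht⟩ := exists_monotone_Icc_subset_open_cover_unitInterval
    (c := fun i => γ ⁻¹' O i) (fun i => (hO i).preimage γ.continuous)
    (fun s _ => by simpa using hK (hγ s))
  have key : ∀ m, P _ _ (FundamentalGroupoid.fromPath (.mk (γ.subpath (t 0) (t m)))) := by
    intro m
    have sub : ∀ m m', m ≤ m' → (∃ i, Icc (t m) (t m') ⊆ γ ⁻¹' O i) →
        P _ _ (FundamentalGroupoid.fromPath (.mk (γ.subpath (t m) (t m')))) := by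
      rintro m m' hm ⟨i, hi⟩
      refine small i _ _ _ ⟨_, fun s => ?_, rfl⟩
      have : γ.subpath (t m) (t m') s ∈ range (γ.subpath (t m) (t m')) := ⟨s, rfl⟩
      rw [Path.range_subpath_of_le _ _ _ (htm hm)] at this
      obtain ⟨r, hr, hr'⟩ := this
      exact hr' ▸ ⟨hi hr, hγ r⟩
    induction m with
    | zero =>
      refine sub 0 0 le_rfl ?_
      obtain ⟨i, hi⟩ := ht 0
      exact ⟨i, (Icc_subset_Icc_right (htm zero_le_one)).trans hi⟩
    | succ m ih =>
      have h2 := comp _ _ _ _ _ ih (sub m (m + 1) m.le_succ (ht m))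
      have e : (FundamentalGroupoid.fromPath (.mk (γ.subpath (t 0) (t m))) ≫
          FundamentalGroupoid.fromPath (.mk (γ.subpath (t m) (t (m + 1)))) :
            FundamentalGroupoid.mk _ ⟶ .mk _) =
          FundamentalGroupoid.fromPath (.mk (γ.subpath (t 0) (t (m + 1)))) :=
        Path.Homotopic.Quotient.eq.2 ⟨Path.Homotopy.subpathTransSubpath γ _ _ _⟩
      rwa [e] at h2
  have := key n
  rw [ht0, hn n le_rfl, Path.subpath_zero_one] at this
  -- The endpoints `γ 0` and `γ 1` agree with `a` and `b` only propositionally, so `P` is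
  -- transported along these equalities.
  have aux : ∀ (a' b' : T) (ha : a' = a) (hb : b' = b),
      P a' b' (FundamentalGroupoid.fromPath (.mk (γ.cast ha hb))) → P a b (.mk γ) := by
    rintro _ _ rfl rfl h
    exact h
  exact aux _ _ _ _ this

/-- A set with a finite cover by relatively open path-connected pieces such that intersecting
pairs of pieces are simply connected in `T` has a finitely generated image on `π₁`. -/
theorem loopSubgroup_fg {ι : Type*} [Finite ι] {K : Set T} {O : ι → Set T}
    (hO : ∀ i, IsOpen (O i)) (hK : K ⊆ ⋃ i, O i)
    (c : ι → T)
    (conn : ∀ i, ∀ a ∈ O i ∩ K, ∃ q : FundamentalGroupoid.mk (c i) ⟶ .mk a, InSet (O i ∩ K) q)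
    (thin : ∀ i j, (O i ∩ O j ∩ K).Nonempty → ∀ (a b : T)
      (p q : FundamentalGroupoid.mk a ⟶ .mk b),
      InSet ((O i ∪ O j) ∩ K) p → InSet ((O i ∪ O j) ∩ K) q → p = q)
    (x : T) (hx : x ∈ K) : (loopSubgroup K x hx).FG := by
  classical
  choose s hs using conn
  -- Only pieces whose centre can be reached from `x` inside `K` matter. Each point of such a piece
  -- gets the arrow `g` from `x` through the centre.
  let ι' := {i : ι // ∃ q : FundamentalGroupoid.mk x ⟶ .mk (c i), InSet K q}
  choose p hp using fun i : ι' => i.2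
  let g : ∀ (i : ι') (a : T), a ∈ O i ∩ K → (FundamentalGroupoid.mk x ⟶ .mk a) :=
    fun i a ha => p i ≫ s i a ha
  have hsK : ∀ i a ha, InSet K (s i a ha) := fun i a ha => (hs i a ha).mono inter_subset_right
  have hg : ∀ i a ha, InSet K (g i a ha) := fun i a ha => (hp i).comp (hsK i a ha)
  have hsl : ∀ i j a ha, InSet ((O i ∪ O j) ∩ K) (s i a ha) := fun i j a ha =>
    (hs i a ha).mono (inter_subset_inter_left _ subset_union_left)
  have hsr : ∀ i j a ha, InSet ((O i ∪ O j) ∩ K) (s j a ha) := fun i j a ha =>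
    (hs j a ha).mono (inter_subset_inter_left _ subset_union_right)
  let gen : ι' × ι' → FundamentalGroup T x := fun ij =>
    if h : (O ij.1 ∩ O ij.2 ∩ K).Nonempty then
      g ij.1 h.some ⟨h.some_mem.1.1, h.some_mem.2⟩ ≫
        Groupoid.inv (g ij.2 h.some ⟨h.some_mem.1.2, h.some_mem.2⟩)
    else 1
  -- By `thin`, passing from centre to centre does not depend on the common point, even if the
  -- intersection is disconnected. So one generator per pair suffices.
  have gen_eq : ∀ (i j : ι') (a : T) (hi : a ∈ O i ∩ K) (hj : a ∈ O j ∩ K),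
      g i a hi ≫ Groupoid.inv (g j a hj) = gen (i, j) := by
    intro i j a hi hj
    have h : (O i ∩ O j ∩ K).Nonempty := ⟨a, ⟨hi.1, hj.1⟩, hi.2⟩
    have hb := h.some_mem
    have := thin i j h _ _ (s i a hi ≫ Groupoid.inv (s j a hj))
      (s i h.some ⟨hb.1.1, hb.2⟩ ≫ Groupoid.inv (s j h.some ⟨hb.1.2, hb.2⟩))
      ((hsl i j a _).comp (hsr i j a _).inv) ((hsl i j _ _).comp (hsr i j _ _).inv)
    simp only [gen, g, dif_pos h]
    simp only [Groupoid.inv_eq_inv, IsIso.inv_comp, Category.assoc] at this ⊢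
    rw [reassoc_of% this]
  obtain ⟨i₀, hi₀⟩ := mem_iUnion.1 (hK hx)
  have hx₀ : x ∈ O i₀ ∩ K := ⟨hi₀, hx⟩
  let i₀' : ι' := ⟨i₀, _, ((hsK i₀ x hx₀).inv)⟩
  let g₀ : FundamentalGroup T x := g i₀' x hx₀
  let S : Subgroup (FundamentalGroup T x) := Subgroup.closure (range gen ∪ {g₀})
  have hgenS : ∀ ij, gen ij ∈ S := fun ij => Subgroup.subset_closure (Or.inl ⟨ij, rfl⟩)
  have hS : S.FG := (Subgroup.fg_iff _).2 ⟨_, rfl, (finite_range gen).union (finite_singleton _)⟩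
  suffices loopSubgroup K x hx = S by rwa [this]
  apply le_antisymm
  · intro q hq
    -- Existence of a reachable piece at `b` is part of the property, since composing two arrows
    -- needs one at the middle point.
    have key := InSet.induction hO hK (fun a b q => ∀ (i : ι') (ha : a ∈ O i ∩ K),
      (∃ j : ι', b ∈ O j ∩ K) ∧ ∀ (j : ι') (hb : b ∈ O j ∩ K),
        ∃ r : FundamentalGroup T x, r ∈ S ∧ g i a ha ≫ q ≫ Groupoid.inv (g j b hb) = r) ?_ ?_
      (mem_loopSubgroup.1 hq) i₀' hx₀
    · obtain ⟨r, hr, e⟩ := key.2 i₀' hx₀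
      have h2 : g₀ ∈ S := Subgroup.subset_closure (Or.inr rfl)
      have h3 := S.mul_mem (S.mul_mem h2 hr) (S.inv_mem h2)
      have e : Groupoid.inv (g i₀' x hx₀) ≫ r ≫ g i₀' x hx₀ = q := by
        rw [← e]; simp
      rw [← e]
      exact h3
    · intro m a b q hq i ha
      have ham := hq.source_mem
      have hbm := hq.target_mem
      let m' : ι' := ⟨m, _, (hg i a ha).comp (hsK m a ham).inv⟩
      refine ⟨⟨m', hbm⟩, fun j hb => ?_⟩
      have e1 := gen_eq i m' a ha ham
      have e2 := gen_eq m' j b hbm hb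
      have e3 := thin m m ⟨a, ⟨ham.1, ham.1⟩, ham.2⟩ _ _ (s m a ham ≫ q) (s m b hbm)
        ((hsl m m a ham).comp (hq.mono (inter_subset_inter_left _ subset_union_left)))
        (hsl m m b hbm)
      have e4 : g m' a ham ≫ q = g m' b hbm := by simp only [g, Category.assoc, m', e3]
      have e5 : g i a ha ≫ q ≫ Groupoid.inv (g j b hb) =
          (g i a ha ≫ Groupoid.inv (g m' a ham)) ≫ (g m' b hbm ≫ Groupoid.inv (g j b hb)) := by
        rw [← e4]; simp
      rw [e5, e1, e2]
      exact ⟨_, S.mul_mem (hgenS _) (hgenS _), rfl⟩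
    · intro a b c p q hp hq i ha
      obtain ⟨⟨m, hm⟩, hp⟩ := hp i ha
      obtain ⟨hj, hq⟩ := hq m hm
      refine ⟨hj, fun j hc => ?_⟩
      obtain ⟨r, hr, e⟩ := hp m hm
      obtain ⟨r', hr', e'⟩ := hq j hc
      -- The product in `FundamentalGroup` is composition in the reverse order.
      refine ⟨_, S.mul_mem hr' hr, ?_⟩
      show _ = r ≫ r'
      rw [← e, ← e']
      simp
  · refine (Subgroup.closure_le _).2 ?_
    rintro _ (⟨⟨i, j⟩, rfl⟩ | rfl)
    · by_cases h : (O i ∩ O j ∩ K).Nonempty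
      · simp only [gen, dif_pos h]
        exact (hg i _ _).comp (hg j _ _).inv
      · simp only [gen, dif_neg h]
        exact Subgroup.one_mem _
    · exact hg i₀' x hx₀

end FundamentalGroupoid

/-! ### Straight-line homotopies and open stars in the realization -/

namespace FinSimplicialComplex

open FundamentalGroupoid

variable {X Y P : FinSimplicialComplex.{u}}

theorem face_nonempty {s : Finset X.V} (hs : s ∈ X.complex.faces) : s.Nonempty :=
  (X.complex.isRelLowerSet_faces hs).1

theorem face_of_subset {s t : Finset X.V} (hs : s ∈ X.complex.faces) (hts : t ⊆ s)
    (ht : t.Nonempty) : t ∈ X.complex.faces :=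
  (X.complex.isRelLowerSet_faces hs).2 hts ht

/-- The points `a` and `b` lie in a common closed simplex. -/
def InCommonFace (a b : X.realization) : Prop :=
  ∃ s ∈ X.complex.faces, (∀ v, a.1 v ≠ 0 → v ∈ s) ∧ ∀ v, b.1 v ≠ 0 → v ∈ s

theorem segment_mem {a b : X.realization} (h : InCommonFace a b) (t : I) :
    (fun v => (1 - t.1) * a.1 v + t.1 * b.1 v) ∈ X.realization := by
  obtain ⟨s, hs, ha, hb⟩ := h
  refine ⟨convex_stdSimplex ℝ X.V a.2.1 b.2.1 (sub_nonneg.2 t.2.2) t.2.1 (by ring), s, hs,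
    fun v hv => ?_⟩
  by_contra hvs
  have h1 : a.1 v = 0 := by by_contra h; exact hvs (ha v h)
  have h2 : b.1 v = 0 := by by_contra h; exact hvs (hb v h)
  simp [h1, h2] at hv

/-- The straight-line homotopy between maps that are pointwise in a common simplex. -/
def straightHomotopy {Y : Type*} [TopologicalSpace Y] (f g : C(Y, X.realization))
    (h : ∀ y, InCommonFace (f y) (g y)) : f.Homotopy g where
  toFun p := ⟨fun v => (1 - p.1.1) * (f p.2).1 v + p.1.1 * (g p.2).1 v, segment_mem (h p.2) p.1⟩
  continuous_toFun := by
    have hf : Continuous fun p : I × Y => (f p.2).1 :=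
      continuous_subtype_val.comp (f.continuous.comp continuous_snd)
    have hg : Continuous fun p : I × Y => (g p.2).1 :=
      continuous_subtype_val.comp (g.continuous.comp continuous_snd)
    refine Continuous.subtype_mk (continuous_pi fun v => ?_) _
    have hf' := (continuous_apply v).comp hf
    have hg' := (continuous_apply v).comp hg
    exact ((continuous_const.sub (continuous_subtype_val.comp continuous_fst)).mul hf').add
      ((continuous_subtype_val.comp continuous_fst).mul hg')
  map_zero_left y := Subtype.ext (by simp)
  map_one_left y := Subtype.ext (by simp)

/-- A segment in a set gives an arrow in that set. -/
theorem exists_inSet_of_segment {K : Set X.realization} {a b : X.realization}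
    (h : InCommonFace a b)
    (hK : ∀ t : I, (⟨fun v => (1 - t.1) * a.1 v + t.1 * b.1 v, segment_mem h t⟩ :
      X.realization) ∈ K) :
    ∃ q : FundamentalGroupoid.mk a ⟶ .mk b, InSet K q := by
  let H := straightHomotopy (ContinuousMap.const Unit a) (ContinuousMap.const Unit b) fun _ => h
  exact ⟨.mk (H.evalAt ()), H.evalAt (), fun t => hK t, rfl⟩

/-- The open star of a vertex. -/
def openStar (v : X.V) : Set X.realization := {x | 0 < x.1 v}

open Classical in
/-- A vertex as a point of the realization. -/
noncomputable def vertexPoint (v : X.V) : X.realization :=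
  ⟨Pi.single v 1, ⟨single_mem_stdSimplex ℝ v, {v}, X.complex.singleton_mem v, fun w hw => by
    by_contra h
    exact hw (Pi.single_eq_of_ne (by simpa using h) _)⟩⟩

open Classical in
theorem inCommonFace_vertexPoint {v : X.V} {x : X.realization} (hx : x ∈ openStar v) :
    InCommonFace x (vertexPoint v) := by
  obtain ⟨s, hs, h⟩ := x.2.2
  refine ⟨s, hs, h, fun w hw => ?_⟩
  have : w = v := by
    by_contra h
    exact hw (Pi.single_eq_of_ne h _)
  exact this ▸ h v (ne_of_gt hx)

/-- Open stars are simply connected in the realization. -/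
theorem eq_of_inSet_openStar {v : X.V} {a b : X.realization}
    {p q : FundamentalGroupoid.mk a ⟶ .mk b} (hp : InSet (openStar v) p)
    (hq : InSet (openStar v) q) : p = q := by
  let H := straightHomotopy (⟨Subtype.val, continuous_subtype_val⟩ : C(openStar v, X.realization))
    (.const _ (vertexPoint v)) fun y => inCommonFace_vertexPoint y.2
  let d : ∀ y : openStar v, FundamentalGroupoid.mk y.1 ⟶ .mk (vertexPoint v) :=
    fun y => .mk (H.evalAt y)
  -- The contraction `H` ends in a constant map, so its naturality square degenerates to a triangle
  -- that determines `p`.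
  have key : ∀ {a b : X.realization} (ha : a ∈ openStar v) (hb : b ∈ openStar v)
      {p : FundamentalGroupoid.mk a ⟶ .mk b}, InSet (openStar v) p → p ≫ d ⟨b, hb⟩ = d ⟨a, ha⟩ := by
    rintro a b ha hb _ ⟨γ, hγ, rfl⟩
    let γ' : Path (⟨a, ha⟩ : openStar v) ⟨b, hb⟩ :=
      { toFun := fun t => ⟨γ t, hγ t⟩
        continuous_toFun := by fun_prop
        source' := Subtype.ext γ.source
        target' := Subtype.ext γ.target }
    have := mk_comp_evalAt H γ'
    have e : (FundamentalGroupoid.fromPath (.mk (γ'.map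
        (ContinuousMap.const (openStar v) (vertexPoint v)).continuous)) :
          FundamentalGroupoid.mk (vertexPoint v) ⟶ .mk (vertexPoint v)) = 𝟙 _ := rfl
    exact this.trans ((congrArg (d ⟨a, ha⟩ ≫ ·) e).trans (Category.comp_id _))
  have h1 := key hp.source_mem hp.target_mem hp
  have h2 := key hp.source_mem hp.target_mem hq
  exact (cancel_mono (d ⟨b, hp.target_mem⟩)).1 (h1.trans h2.symm)

/-! ### Compactness and finite generation -/

theorem isClosed_realization : IsClosed X.realization := by
  have : X.realization = stdSimplex ℝ X.V ∩ ⋃ s ∈ X.complex.faces,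
      {x : X.V → ℝ | ∀ v, v ∉ s → x v = 0} := by
    ext x
    simp only [realization, mem_inter_iff, mem_ofPred_eq, mem_iUnion, exists_prop]
    refine and_congr_right fun _ => exists_congr fun s => and_congr_right fun _ =>
      forall_congr' fun v => ?_
    rw [not_imp_comm]
  rw [this]
  refine (isClosed_stdSimplex ℝ X.V).inter ((toFinite _).isClosed_biUnion fun s _ => ?_)
  simp only [ofPred_forall]
  exact isClosed_iInter fun v => isClosed_iInter fun _ =>
    isClosed_eq (continuous_apply v) continuous_const

instance : CompactSpace X.realization :=
  isCompact_iff_compactSpace.1 ((isCompact_stdSimplex ℝ X.V).of_isClosed_subset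
    isClosed_realization fun _ hx => hx.1)

theorem realization_nonneg (x : X.realization) (v : X.V) : 0 ≤ x.1 v := x.2.1.1 v

theorem realization_sum (x : X.realization) : ∑ v, x.1 v = 1 := x.2.1.2

theorem exists_inv_card_le (x : X.realization) : ∃ v, (Fintype.card X.V : ℝ)⁻¹ ≤ x.1 v := by
  by_contra! h
  have hne : (Finset.univ : Finset X.V).Nonempty := by
    by_contra h0
    have := realization_sum x
    rw [Finset.not_nonempty_iff_eq_empty.1 h0] at this
    simp at this
  have := Finset.sum_lt_sum_of_nonempty hne fun v _ => h v
  rw [realization_sum] at this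
  have hc : (Fintype.card X.V : ℝ) ≠ 0 := by
    have := Finset.card_pos.2 hne
    rw [Finset.card_univ] at this
    positivity
  simp [hc] at this

theorem abs_sub_le_dist (x y : X.realization) (v : X.V) : |x.1 v - y.1 v| ≤ dist x y := by
  rw [← Real.dist_eq]
  exact dist_le_pi_dist x.1 y.1 v

open Classical in
/-- The image of `π₁` of a closed subset that is convex in every simplex is finitely generated. -/
theorem loopSubgroup_fg_of_convex {K : Set X.realization} (hK : IsClosed K)
    (conv : ∀ a ∈ K, ∀ b ∈ K, ∀ (h : InCommonFace a b) (t : I),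
      (⟨fun v => (1 - t.1) * a.1 v + t.1 * b.1 v, segment_mem h t⟩ : X.realization) ∈ K)
    (x : X.realization) (hx : x ∈ K) : (loopSubgroup K x hx).FG := by
  have hcard : (0 : ℝ) < (Fintype.card X.V : ℝ)⁻¹ := by
    obtain ⟨v, _⟩ := exists_inv_card_le x
    have : Nonempty X.V := ⟨v⟩
    positivity
  -- Staying below the nonzero coordinates of `y` puts every point of the ball in a common face with
  -- `y`. The bound by half of the inverse cardinality forces two meeting balls into one open star.
  have hδ : ∀ y : X.realization, ∃ δ : ℝ, 0 < δ ∧ δ ≤ (Fintype.card X.V : ℝ)⁻¹ / 2 ∧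
      ∀ v, y.1 v ≠ 0 → δ ≤ y.1 v := by
    intro y
    have h1 : ∀ᶠ δ : ℝ in nhdsWithin 0 (Ioi 0), ∀ v, y.1 v ≠ 0 → δ ≤ y.1 v := by
      refine Filter.eventually_all.2 fun v => ?_
      by_cases hv : y.1 v = 0
      · simp [hv]
      · filter_upwards [Ioo_mem_nhdsGT ((realization_nonneg y v).lt_of_ne' hv)] with δ hδ _
        exact hδ.2.le
    obtain ⟨δ, h1, h2⟩ := (h1.and (Ioo_mem_nhdsGT (half_pos hcard))).exists
    exact ⟨δ, h2.1, h2.2.le, h1⟩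
  choose δ δ0 δ1 δ2 using hδ
  obtain ⟨t, htK, ht⟩ := hK.isCompact.elim_nhds_subcover (fun y => Metric.ball y (δ y))
    fun y _ => Metric.ball_mem_nhds y (δ0 y)
  refine loopSubgroup_fg (ι := t) (O := fun y => Metric.ball y.1 (δ y.1))
    (fun _ => Metric.isOpen_ball) (by simpa [iUnion_subtype] using ht) (fun y => y.1) ?_ ?_ x hx
  · rintro ⟨y, hy⟩ a ⟨ha, haK⟩
    have hc : InCommonFace y a := by
      obtain ⟨s, hs, h⟩ := a.2.2
      refine ⟨s, hs, fun v hv => h v fun h0 => ?_, h⟩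
      have h1 := abs_sub_le_dist a y v
      have h2 := δ2 y v hv
      rw [h0, zero_sub, abs_neg, abs_of_nonneg (realization_nonneg y v)] at h1
      exact absurd ha (by simpa using h2.trans h1)
    refine exists_inSet_of_segment hc fun t => ⟨?_, conv _ (htK y hy) _ haK hc t⟩
    refine Metric.mem_ball.2 (lt_of_le_of_lt ?_ (Metric.mem_ball.1 ha))
    refine (dist_pi_le_iff dist_nonneg).2 fun v => ?_
    rw [Real.dist_eq]
    have : (1 - t.1) * y.1 v + t.1 * a.1 v - y.1 v = t.1 * (a.1 v - y.1 v) := by ring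
    rw [this, abs_mul, abs_of_nonneg t.2.1]
    exact (mul_le_of_le_one_left (abs_nonneg _) t.2.2).trans (abs_sub_le_dist a y v)
  · rintro ⟨y, hy⟩ ⟨z, hz⟩ ⟨w, ⟨hwy, hwz⟩, hwK⟩ a b p q hp hq
    obtain ⟨v, hv⟩ := exists_inv_card_le w
    -- Moving from `w` within the ball changes the coordinate at `v` by less than `2 * δ y`, which
    -- is at most its value at `w`.
    have key : ∀ y : X.realization, w ∈ Metric.ball y (δ y) →
        Metric.ball y (δ y) ⊆ openStar v := by
      intro y hw a ha
      have h1 := abs_sub_le_dist w a v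
      have h2 : dist w a < δ y + δ y :=
        (dist_triangle_right w a y).trans_lt (add_lt_add hw ha)
      have h3 := le_abs_self (w.1 v - a.1 v)
      have h4 := δ1 y
      show 0 < a.1 v
      linarith
    have hsub : (Metric.ball y (δ y) ∪ Metric.ball z (δ z)) ∩ K ⊆ openStar v :=
      inter_subset_left.trans (union_subset (key y hwy) (key z hwz))
    exact eq_of_inSet_openStar (hp.mono hsub) (hq.mono hsub)

/-! ### Simplicial maps, stars of barycentres and the first claim -/

open Classical in
theorem SimplicialMap.realize_apply (f : SimplicialMap X P) (x : X.realization) (w : P.V) :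
    (f.realize x).1 w = ∑ v with f.toFun v = w, x.1 v := rfl

theorem SimplicialMap.continuous_realize (f : SimplicialMap X P) : Continuous f.realize := by
  refine Continuous.subtype_mk (continuous_pi fun w => continuous_finsetSum _ fun v _ => ?_) _
  exact (continuous_apply v).comp continuous_subtype_val

open Classical in
theorem SimplicialMap.realize_segment (f : SimplicialMap X P) {a b : X.realization}
    (h : InCommonFace a b) (t : I) (w : P.V) :
    (f.realize ⟨_, segment_mem h t⟩).1 w =
      (1 - t.1) * (f.realize a).1 w + t.1 * (f.realize b).1 w := by
  simp only [f.realize_apply, Finset.sum_add_distrib, Finset.mul_sum]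

/-- The points of the realization whose coordinates in `ρ` are positive and larger than all the
others: the open star of the barycentre of `ρ` in the barycentric subdivision. -/
def barycentreStar (P : FinSimplicialComplex.{u}) (ρ : Finset P.V) : Set P.realization :=
  {y | ∀ v ∈ ρ, 0 < y.1 v ∧ ∀ w ∉ ρ, y.1 w < y.1 v}

theorem isOpen_barycentreStar (ρ : Finset P.V) : IsOpen (barycentreStar P ρ) := by
  classical
  have hc : ∀ v, Continuous fun y : P.realization => y.1 v := fun v =>
    (continuous_apply v).comp continuous_subtype_val
  have : barycentreStar P ρ = ⋂ v ∈ ρ, ({y | 0 < y.1 v} ∩ ⋂ w ∈ ρᶜ, {y | y.1 w < y.1 v}) := by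
    ext y
    simp [barycentreStar]
  rw [this]
  exact isOpen_biInter_finset fun v _ => (isOpen_lt continuous_const (hc v)).inter
    (isOpen_biInter_finset fun w _ => isOpen_lt (hc w) (hc v))

/-- Vertices `v ∈ ρ \ τ` and `w ∈ τ \ ρ` would each have the larger coordinate. So stars of distinct
faces of equal size are disjoint, and the faces whose stars contain a given point form a chain. -/
theorem subset_of_mem_barycentreStar {ρ τ : Finset P.V} {y : P.realization}
    (hρ : y ∈ barycentreStar P ρ) (hτ : y ∈ barycentreStar P τ) : ρ ⊆ τ ∨ τ ⊆ ρ := by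
  by_contra! h
  obtain ⟨v, hv, hv'⟩ := Finset.not_subset.1 h.1
  obtain ⟨w, hw, hw'⟩ := Finset.not_subset.1 h.2
  exact lt_asymm ((hρ v hv).2 w hw') ((hτ w hw).2 v hv')

/-- Nonemptiness is essential: the star of `∅` is the whole realization. -/
theorem face_of_mem_barycentreStar {ρ : Finset P.V} (hne : ρ.Nonempty) {y : P.realization}
    (h : y ∈ barycentreStar P ρ) : ρ ∈ P.complex.faces := by
  obtain ⟨s, hs, hy⟩ := y.2.2
  exact face_of_subset hs (fun v hv => hy v (h v hv).1.ne') hne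

/-- The vertices where `y` attains its maximum form such a face. -/
theorem exists_mem_barycentreStar (y : P.realization) :
    ∃ ρ ∈ P.complex.faces, y ∈ barycentreStar P ρ := by
  classical
  obtain ⟨v₀, h₀⟩ := exists_inv_card_le y
  have : Nonempty P.V := ⟨v₀⟩
  obtain ⟨m, hm⟩ := Finite.exists_max y.1
  have hpos : 0 < y.1 m := lt_of_lt_of_le (by positivity) (h₀.trans (hm v₀))
  have hmem : y ∈ barycentreStar P {v | y.1 v = y.1 m} := by
    intro v hv
    have hv : y.1 v = y.1 m := by simpa using hv
    exact ⟨hv ▸ hpos, fun w hw => hv ▸ (hm w).lt_of_ne (by simpa using hw)⟩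
  exact ⟨_, face_of_mem_barycentreStar ⟨m, by simp⟩ hmem, hmem⟩

open Classical in
/-- The barycentre of a face. -/
noncomputable def barycentre (ρ : Finset P.V) (hρ : ρ ∈ P.complex.faces) : P.realization :=
  ⟨fun w => if w ∈ ρ then (ρ.card : ℝ)⁻¹ else 0, ⟨fun w => by dsimp only; positivity, by
    have := Finset.card_pos.2 (face_nonempty hρ)
    simp [this.ne']⟩, ρ, hρ, fun w hw => by
    by_contra h
    simp [h] at hw⟩

open Classical in
/-- The retraction of the preimage of the open star of a barycentre to the fibre over it. -/
noncomputable def fibreRetraction (f : SimplicialMap X P) (ρ : Finset P.V)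
    (hρ : ρ ∈ P.complex.faces) (x : X.realization) (hx : f.realize x ∈ barycentreStar P ρ) :
    X.realization :=
  ⟨fun v => if f.toFun v ∈ ρ then x.1 v / (ρ.card * (f.realize x).1 (f.toFun v)) else 0, by
    -- Blocks over vertices outside `ρ` are erased; the block over each vertex of `ρ` is rescaled to
    -- mass `1 / ρ.card`.
    have hfib : ∀ w, ∑ v with f.toFun v = w, (if f.toFun v ∈ ρ then
        x.1 v / (ρ.card * (f.realize x).1 (f.toFun v)) else 0) =
          (barycentre ρ hρ).1 w := by
      intro w
      rw [Finset.sum_congr rfl (g := fun v => if w ∈ ρ then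
        x.1 v / (ρ.card * (f.realize x).1 w) else 0) (fun v hv => by
          rw [(Finset.mem_filter.1 hv).2])]
      by_cases hw : w ∈ ρ
      · have h1 := (hx w hw).1.ne'
        simp only [hw, if_true, barycentre, ← Finset.sum_div, ← f.realize_apply]
        field_simp
      · simp [hw, barycentre]
    refine ⟨⟨fun v => ?_, ?_⟩, ?_⟩
    · dsimp only
      split_ifs
      · exact div_nonneg (realization_nonneg x v)
          (mul_nonneg (Nat.cast_nonneg _) (realization_nonneg _ _))
      · exact le_rfl
    · rw [← Finset.sum_fiberwise Finset.univ f.toFun, Finset.sum_congr rfl fun w _ => hfib w]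
      exact realization_sum _
    · obtain ⟨s, hs, h⟩ := x.2.2
      refine ⟨s, hs, fun v hv => h v fun h0 => hv ?_⟩
      simp [h0]⟩

open Classical in
theorem realize_fibreRetraction (f : SimplicialMap X P) (ρ : Finset P.V)
    (hρ : ρ ∈ P.complex.faces) (x : X.realization) (hx : f.realize x ∈ barycentreStar P ρ) :
    f.realize (fibreRetraction f ρ hρ x hx) = barycentre ρ hρ := by
  refine Subtype.ext (funext fun w => ?_)
  rw [f.realize_apply, Finset.sum_congr rfl (g := fun v => if w ∈ ρ then
    x.1 v / (ρ.card * (f.realize x).1 w) else 0) (fun v hv => by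
      simp only [fibreRetraction, (Finset.mem_filter.1 hv).2])]
  by_cases hw : w ∈ ρ
  · have h1 := (hx w hw).1.ne'
    simp only [hw, if_true, barycentre, ← Finset.sum_div, ← f.realize_apply]
    field_simp
  · simp [hw, barycentre]

theorem inCommonFace_fibreRetraction (f : SimplicialMap X P) (ρ : Finset P.V)
    (hρ : ρ ∈ P.complex.faces) (x : X.realization) (hx : f.realize x ∈ barycentreStar P ρ) :
    InCommonFace x (fibreRetraction f ρ hρ x hx) := by
  obtain ⟨s, hs, h⟩ := x.2.2
  refine ⟨s, hs, h, fun v hv => h v fun h0 => hv ?_⟩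
  simp [fibreRetraction, h0]

theorem continuous_fibreRetraction (f : SimplicialMap X P) (ρ : Finset P.V)
    (hρ : ρ ∈ P.complex.faces) :
    Continuous fun x : f.realize ⁻¹' barycentreStar P ρ =>
      fibreRetraction f ρ hρ x.1 x.2 := by
  classical
  refine Continuous.subtype_mk (continuous_pi fun v => ?_) _
  by_cases hv : f.toFun v ∈ ρ
  · simp only [hv, if_true]
    have h1 : Continuous fun x : f.realize ⁻¹' barycentreStar P ρ => x.1.1 v :=
      (continuous_apply v).comp (continuous_subtype_val.comp continuous_subtype_val)
    have h2 : Continuous fun x : f.realize ⁻¹' barycentreStar P ρ =>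
        (f.realize x.1).1 (f.toFun v) :=
      (continuous_apply _).comp (continuous_subtype_val.comp
        (f.continuous_realize.comp continuous_subtype_val))
    refine h1.div (continuous_const.mul h2) fun x => mul_ne_zero ?_ (x.2 _ hv).1.ne'
    exact_mod_cast (Finset.card_pos.2 (face_nonempty hρ)).ne'
  · simp only [hv, if_false]
    exact continuous_const

/-- The image is the segment from `f.realize x` to the barycentre; the strict inequalities defining
the star hold at both ends, hence in between. -/
theorem realize_segment_mem_barycentreStar (f : SimplicialMap X P) {ρ : Finset P.V}
    (hρ : ρ ∈ P.complex.faces) {x : X.realization} (hx : f.realize x ∈ barycentreStar P ρ)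
    (t : I) : f.realize ⟨_, segment_mem (inCommonFace_fibreRetraction f ρ hρ x hx) t⟩ ∈
      barycentreStar P ρ := by
  intro v hv
  have hc : (0 : ℝ) < (ρ.card : ℝ)⁻¹ := by
    have := Finset.card_pos.2 (face_nonempty hρ)
    positivity
  have h1 : (barycentre ρ hρ).1 v = (ρ.card : ℝ)⁻¹ := by simp [barycentre, hv]
  have conv : ∀ a b c d : ℝ, a < b → c < d →
      (1 - t.1) * a + t.1 * c < (1 - t.1) * b + t.1 * d := by
    intro a b c d hab hcd
    rcases t.2.1.eq_or_lt with h | h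
    · simpa [← h] using hab
    · exact add_lt_add_of_le_of_lt (mul_le_mul_of_nonneg_left hab.le (sub_nonneg.2 t.2.2))
        (mul_lt_mul_of_pos_left hcd h)
  rw [f.realize_segment (inCommonFace_fibreRetraction f ρ hρ x hx), realize_fibreRetraction, h1]
  refine ⟨by simpa using conv 0 _ 0 _ (hx v hv).1 hc, fun w hw => ?_⟩
  have h2 : (barycentre ρ hρ).1 w = 0 := by simp [barycentre, hw]
  rw [f.realize_segment (inCommonFace_fibreRetraction f ρ hρ x hx), realize_fibreRetraction, h2]
  exact conv _ _ _ _ ((hx v hv).2 w hw) hc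

/-- The union of the preimages of the open stars of the barycentres of `i`-vertex faces. -/
def levelSet (f : SimplicialMap X P) (i : ℕ) : Set X.realization :=
  ⋃ ρ ∈ {ρ : Finset P.V | ρ.card = i}, f.realize ⁻¹' barycentreStar P ρ

theorem isOpen_levelSet (f : SimplicialMap X P) (i : ℕ) : IsOpen (levelSet f i) :=
  isOpen_biUnion fun ρ _ => (isOpen_barycentreStar ρ).preimage f.continuous_realize

/-- The level set is a disjoint union of open preimages, and a path is connected. -/
theorem mem_preimage_of_inSet_levelSet (f : SimplicialMap X P) {ρ : Finset P.V}
    {x : X.realization} (hx : f.realize x ∈ barycentreStar P ρ)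
    {q : FundamentalGroupoid.mk x ⟶ .mk x} (hq : InSet (levelSet f ρ.card) q) :
    InSet (f.realize ⁻¹' barycentreStar P ρ) q := by
  obtain ⟨γ, hγ, rfl⟩ := hq
  refine ⟨γ, fun t => ?_, rfl⟩
  have hpre : _root_.IsPreconnected (range γ) := isPreconnected_range γ.continuous
  have := hpre.subset_left_of_subset_union
    (u := f.realize ⁻¹' barycentreStar P ρ)
    (v := ⋃ τ ∈ {τ : Finset P.V | τ.card = ρ.card ∧ τ ≠ ρ}, f.realize ⁻¹' barycentreStar P τ)
    ((isOpen_barycentreStar ρ).preimage f.continuous_realize)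
    (isOpen_biUnion fun τ _ => (isOpen_barycentreStar τ).preimage f.continuous_realize)
    ?_ ?_ ⟨x, mem_range.2 ⟨0, γ.source⟩, hx⟩ (mem_range_self t)
  · exact this
  · refine disjoint_left.2 fun y hy hy' => ?_
    simp only [mem_iUnion, mem_ofPred_eq] at hy'
    obtain ⟨τ, ⟨hc, hne⟩, hτ⟩ := hy'
    rcases subset_of_mem_barycentreStar hy hτ with h | h
    · exact hne (Finset.eq_of_subset_of_card_le h hc.le).symm
    · exact hne (Finset.eq_of_subset_of_card_le h hc.ge)
  · rintro _ ⟨s, rfl⟩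
    have h := hγ s
    simp only [levelSet, mem_iUnion, mem_ofPred_eq] at h
    obtain ⟨τ, hc, hτ⟩ := h
    by_cases hne : τ = ρ
    · exact Or.inl (hne ▸ hτ)
    · exact Or.inr (mem_iUnion₂.2 ⟨τ, ⟨hc, hne⟩, hτ⟩)

theorem isGSet_levelSet (𝒢 : GroupClass.{u}) (h𝒢 : 𝒢.ClosedUnderIso) (f : SimplicialMap X P)
    (hf : ∀ p : P.realization, 𝒢.IsGSet (f.realize ⁻¹' {p})) {i : ℕ} (hi : 0 < i) :
    𝒢.IsGSet (levelSet f i) := by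
  rintro ⟨x, hx⟩
  have hx' := hx
  simp only [levelSet, mem_iUnion, mem_ofPred_eq] at hx'
  obtain ⟨ρ, rfl, hxρ⟩ := hx'
  have hρ := face_of_mem_barycentreStar (Finset.card_pos.1 hi) hxρ
  let r := fibreRetraction f ρ hρ
  have hWU : f.realize ⁻¹' barycentreStar P ρ ⊆ levelSet f ρ.card :=
    subset_biUnion_of_mem (u := fun ρ => f.realize ⁻¹' barycentreStar P ρ)
      (show ρ ∈ {τ : Finset P.V | τ.card = ρ.card} from rfl)
  -- The barycentre lies in its star, being the end of the segment at time `1`.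
  have hFW : f.realize ⁻¹' {barycentre ρ hρ} ⊆ f.realize ⁻¹' barycentreStar P ρ := by
    intro y hy
    have hy : f.realize y = barycentre ρ hρ := hy
    have h1 := realize_segment_mem_barycentreStar f hρ hxρ 1
    have h2 : (⟨_, segment_mem (inCommonFace_fibreRetraction f ρ hρ x hxρ) 1⟩ : X.realization) =
        r x hxρ := Subtype.ext (by simp [r])
    rw [h2, realize_fibreRetraction] at h1
    rwa [mem_preimage, hy]
  have hrx : r x hxρ ∈ f.realize ⁻¹' {barycentre ρ hρ} := realize_fibreRetraction f ρ hρ x hxρ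
  let H := straightHomotopy (⟨Subtype.val, continuous_subtype_val⟩ :
    C(f.realize ⁻¹' barycentreStar P ρ, X.realization))
    ⟨fun y => r y.1 y.2, continuous_fibreRetraction f ρ hρ⟩
    fun y => inCommonFace_fibreRetraction f ρ hρ y.1 y.2
  let d : FundamentalGroupoid.mk x ⟶ .mk (r x hxρ) := .mk (H.evalAt ⟨x, hxρ⟩)
  have hd : InSet (f.realize ⁻¹' barycentreStar P ρ) d :=
    ⟨H.evalAt ⟨x, hxρ⟩, fun t => realize_segment_mem_barycentreStar f hρ hxρ t, rfl⟩
  have hF := hf (barycentre ρ hρ) ⟨r x hxρ, hrx⟩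
  rw [range_map_eq_loopSubgroup] at hF ⊢
  refine h𝒢 _ _ (nonempty_mulEquiv_of_conj d _ _ ?_ ?_) hF
  -- Conjugating by the track `d` of `x` replaces a loop by its retraction, which lies in the fibre.
  · intro q hq
    obtain ⟨γ, hγ, rfl⟩ := mem_preimage_of_inSet_levelSet f hxρ hq
    let γ' : Path (⟨x, hxρ⟩ : f.realize ⁻¹' barycentreStar P ρ) ⟨x, hxρ⟩ :=
      { toFun := fun t => ⟨γ t, hγ t⟩
        continuous_toFun := by fun_prop
        source' := Subtype.ext γ.source
        target' := Subtype.ext γ.target }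
    have e := mk_comp_evalAt H γ'
    have e' : Groupoid.inv d ≫ (Path.Homotopic.Quotient.mk γ : FundamentalGroupoid.mk x ⟶ .mk x) ≫
        d = Path.Homotopic.Quotient.mk (γ'.map
          (continuous_fibreRetraction f ρ hρ)) := by
      refine (congrArg (Groupoid.inv d ≫ ·) e).trans ?_
      rw [← Category.assoc]
      exact (congrArg (· ≫ _) (Groupoid.inv_comp d)).trans (Category.id_comp _)
    rw [e']
    exact ⟨_, fun t => realize_fibreRetraction f ρ hρ _ (hγ t), rfl⟩
  · intro q hq
    exact ((hd.mono hWU).comp ((InSet.mono (hFW.trans hWU) hq).comp (hd.mono hWU).inv))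

theorem cat_le_of_fca (𝒢 : GroupClass.{u}) (h𝒢 : 𝒢.ClosedUnderIso)
    (X : FinSimplicialComplex.{u}) (k : ℕ) (h : X.FCA 𝒢 k) :
    𝒢.cat X.realization ≤ (k : ℕ∞) + 1 := by
  classical
  obtain ⟨P, f, hP, hf⟩ := h
  -- Level sets may coincide, so the cover can have fewer than `k + 1` members. Level `0` is
  -- excluded because it is all of `X`.
  let 𝒰 : Finset (Set X.realization) := (Finset.Icc 1 (k + 1)).image (levelSet f)
  have h1 : 𝒰.card ≤ k + 1 := Finset.card_image_le.trans (by simp)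
  have h2 : 𝒢.IsOpenGCover (𝒰 : Set (Set X.realization)) := by
    refine ⟨fun U hU => ?_, eq_univ_of_forall fun x => ?_⟩
    · obtain ⟨i, hi, rfl⟩ := Finset.mem_image.1 hU
      exact ⟨isOpen_levelSet f i, isGSet_levelSet 𝒢 h𝒢 f hf (Finset.mem_Icc.1 hi).1⟩
    · obtain ⟨ρ, hρ, hx⟩ := exists_mem_barycentreStar (f.realize x)
      refine mem_sUnion.2 ⟨levelSet f ρ.card, Finset.mem_image.2 ⟨ρ.card, Finset.mem_Icc.2
        ⟨Finset.card_pos.2 (face_nonempty hρ), hP ρ hρ⟩, rfl⟩, mem_iUnion₂.2 ⟨ρ, rfl, hx⟩⟩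
  calc 𝒢.cat X.realization ≤ (𝒰.card : ℕ∞) :=
        iInf₂_le 𝒰.card ⟨_, h2, encard_coe_eq_coe_finsetCard _⟩
    _ ≤ (k : ℕ∞) + 1 := by exact_mod_cast h1

/-! ### Barycentric subdivision is injective on `π₁` -/

/-- The face of `X` that is a given vertex of the barycentric subdivision. -/
def vertexFace (s : X.barycentricSubdivision.V) : Finset X.V := Subtype.val s

theorem vertexFace_mem (s : X.barycentricSubdivision.V) : vertexFace s ∈ X.complex.faces :=
  Subtype.property s

theorem vertexFace_injective : Function.Injective (vertexFace (X := X)) :=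
  Subtype.val_injective

theorem mem_faces_barycentricSubdivision {c : Finset X.barycentricSubdivision.V} :
    c ∈ X.barycentricSubdivision.complex.faces ↔ c.Nonempty ∧ ∀ s ∈ c, ∀ t ∈ c,
      vertexFace s ⊆ vertexFace t ∨ vertexFace t ⊆ vertexFace s := Iff.rfl

theorem subset_of_card_le {c : Finset X.barycentricSubdivision.V}
    (hc : c ∈ X.barycentricSubdivision.complex.faces) {s t : X.barycentricSubdivision.V}
    (hs : s ∈ c) (ht : t ∈ c) (h : (vertexFace s).card ≤ (vertexFace t).card) :
    vertexFace s ⊆ vertexFace t := by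
  rcases (mem_faces_barycentricSubdivision.1 hc).2 s hs t ht with h' | h'
  · exact h'
  · exact (Finset.eq_of_subset_of_card_le h' h).symm.subset

theorem card_vertexFace_pos (s : X.barycentricSubdivision.V) : 0 < (vertexFace s).card :=
  Finset.card_pos.2 (face_nonempty (vertexFace_mem s))

/-- Members of a chain are told apart by their cardinalities, which lie between `1` and `k + 1`. -/
theorem DimLE.barycentricSubdivision {k : ℕ} (hX : X.DimLE k) :
    X.barycentricSubdivision.DimLE k := by
  intro c hc
  have h := Finset.card_le_card_of_injOn (s := c) (t := Finset.Icc 1 (k + 1))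
    (fun s => (vertexFace s).card)
    (fun s _ => Finset.mem_coe.2 <| Finset.mem_Icc.2
      ⟨card_vertexFace_pos s, hX _ (vertexFace_mem s)⟩)
    (fun s hs t ht hst => vertexFace_injective ((subset_of_card_le hc hs ht hst.le).antisymm
      (subset_of_card_le hc ht hs hst.ge)))
  simpa using h

open Classical in
/-- The canonical map from the realization of the barycentric subdivision. -/
noncomputable def subdivisionMap (X : FinSimplicialComplex.{u}) :
    C(X.barycentricSubdivision.realization, X.realization) where
  toFun x := ⟨fun v => ∑ s, x.1 s * if v ∈ vertexFace s then ((vertexFace s).card : ℝ)⁻¹ else 0, by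
    refine ⟨⟨fun v => Finset.sum_nonneg fun s _ => mul_nonneg (realization_nonneg x s)
      (by positivity), ?_⟩, ?_⟩
    · rw [Finset.sum_comm, ← realization_sum x]
      refine Finset.sum_congr rfl fun s _ => ?_
      have := (card_vertexFace_pos s).ne'
      rw [← Finset.mul_sum]
      simp [this]
    · obtain ⟨c, hc, hx⟩ := x.2.2
      obtain ⟨t, ht, hmax⟩ := c.exists_max_image (fun s => (vertexFace s).card)
        (mem_faces_barycentricSubdivision.1 hc).1
      refine ⟨vertexFace t, vertexFace_mem t, fun v hv => ?_⟩
      obtain ⟨s, _, hs⟩ := Finset.exists_ne_zero_of_sum_ne_zero hv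
      have hsc := hx s (left_ne_zero_of_mul hs)
      have hvs : v ∈ vertexFace s := by
        by_contra h
        simp [h] at hs
      exact subset_of_card_le hc hsc ht (hmax s hsc) hvs⟩
  continuous_toFun := by
    refine Continuous.subtype_mk (continuous_pi fun v => continuous_finsetSum _ fun s _ => ?_) _
    exact ((continuous_apply s).comp continuous_subtype_val).mul continuous_const

open Classical in
theorem subdivisionMap_apply (x : X.barycentricSubdivision.realization) (v : X.V) :
    (subdivisionMap X x).1 v =
      ∑ s, x.1 s * if v ∈ vertexFace s then ((vertexFace s).card : ℝ)⁻¹ else 0 := rfl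

/-- The faces whose barycentres have a neighbourhood star containing the image of `x` belong
to every simplex of the subdivision containing `x`. -/
theorem mem_of_subdivisionMap_mem_barycentreStar {x : X.barycentricSubdivision.realization}
    {c : Finset X.barycentricSubdivision.V} (hc : c ∈ X.barycentricSubdivision.complex.faces)
    (hx : ∀ s, x.1 s ≠ 0 → s ∈ c) {s : X.barycentricSubdivision.V}
    (hs : subdivisionMap X x ∈ barycentreStar X (vertexFace s)) : s ∈ c := by
  classical
  have h1 : ∀ v ∈ vertexFace s, ∃ t ∈ c, v ∈ vertexFace t := by
    intro v hv
    have h := (hs v hv).1.ne'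
    rw [subdivisionMap_apply] at h
    obtain ⟨t, _, ht⟩ := Finset.exists_ne_zero_of_sum_ne_zero h
    refine ⟨t, hx t (left_ne_zero_of_mul ht), ?_⟩
    by_contra h
    simp [h] at ht
  have h2 : ∀ v ∈ vertexFace s, ∀ w ∉ vertexFace s, ∃ t ∈ c, v ∈ vertexFace t ∧
      w ∉ vertexFace t := by
    intro v hv w hw
    by_contra! h
    refine ((hs v hv).2 w hw).not_ge ?_
    rw [subdivisionMap_apply, subdivisionMap_apply]
    refine Finset.sum_le_sum fun t _ => ?_
    by_cases ht : x.1 t = 0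
    · simp [ht]
    · refine mul_le_mul_of_nonneg_left ?_ (realization_nonneg x t)
      by_cases hvt : v ∈ vertexFace t
      · rw [if_pos hvt, if_pos (h t (hx t ht) hvt)]
      · rw [if_neg hvt]
        positivity
  -- Take the smallest member containing `v`. A vertex of it outside `vertexFace s` would lie in
  -- every member containing `v`, against `h2`.
  have h3 : ∀ v ∈ vertexFace s, ∃ t ∈ c, v ∈ vertexFace t ∧ vertexFace t ⊆ vertexFace s := by
    intro v hv
    obtain ⟨t₀, ht₀, hvt₀⟩ := h1 v hv
    obtain ⟨t, ht, hmin⟩ := (c.filter fun t => v ∈ vertexFace t).exists_min_image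
      (fun t => (vertexFace t).card) ⟨t₀, by simp [ht₀, hvt₀]⟩
    obtain ⟨ht, hvt⟩ := Finset.mem_filter.1 ht
    refine ⟨t, ht, hvt, fun w hw => ?_⟩
    by_contra hws
    obtain ⟨r, hr, hvr, hwr⟩ := h2 v hv w hws
    exact hwr (subset_of_card_le hc ht hr (hmin r (Finset.mem_filter.2 ⟨hr, hvr⟩)) hw)
  obtain ⟨v₀, hv₀⟩ := face_nonempty (vertexFace_mem s)
  obtain ⟨t₀, ht₀, _, hts₀⟩ := h3 v₀ hv₀
  -- The largest member inside `vertexFace s` contains all those given by `h3`, so it equals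
  -- `vertexFace s`.
  obtain ⟨t, ht, hmax⟩ := (c.filter fun t => vertexFace t ⊆ vertexFace s).exists_max_image
    (fun t => (vertexFace t).card) ⟨t₀, by simp [ht₀, hts₀]⟩
  obtain ⟨ht, hts⟩ := Finset.mem_filter.1 ht
  have : s = t := vertexFace_injective <| Finset.Subset.antisymm (fun v hv => by
    obtain ⟨r, hr, hvr, hrs⟩ := h3 v hv
    exact subset_of_card_le hc hr ht (hmax r (Finset.mem_filter.2 ⟨hr, hrs⟩)) hvr) hts
  exact this ▸ ht

open Classical in
/-- A nonnegative function that is positive exactly on the star of the barycentre of `s`. -/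
noncomputable def starWeight (s : Finset X.V) (y : X.realization) : ℝ :=
  ∏ v ∈ s, (y.1 v * ∏ w ∈ sᶜ, max 0 (y.1 v - y.1 w))

theorem starWeight_nonneg (s : Finset X.V) (y : X.realization) : 0 ≤ starWeight s y :=
  Finset.prod_nonneg fun v _ => mul_nonneg (realization_nonneg y v)
    (Finset.prod_nonneg fun _ _ => le_max_left _ _)

theorem starWeight_ne_zero_iff {s : Finset X.V} {y : X.realization} :
    starWeight s y ≠ 0 ↔ y ∈ barycentreStar X s := by
  classical
  simp only [starWeight, Finset.prod_ne_zero_iff, mul_ne_zero_iff, barycentreStar, mem_ofPred_eq,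
    Finset.mem_compl]
  refine forall₂_congr fun v _ => and_congr ?_ (forall₂_congr fun w _ => ?_)
  · exact (realization_nonneg y v).lt_iff_ne'.symm
  · rw [← (le_max_left 0 (y.1 v - y.1 w)).lt_iff_ne', lt_max_iff]
    simp

theorem continuous_starWeight (s : Finset X.V) : Continuous (starWeight (X := X) s) := by
  have hc : ∀ v, Continuous fun y : X.realization => y.1 v := fun v =>
    (continuous_apply v).comp continuous_subtype_val
  exact continuous_finsetProd _ fun v _ => (hc v).mul
    (continuous_finsetProd _ fun w _ => continuous_const.max ((hc v).sub (hc w)))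

theorem sum_starWeight_pos (y : X.realization) :
    0 < ∑ s : X.barycentricSubdivision.V, starWeight (vertexFace s) y := by
  obtain ⟨s, hs, hy⟩ := exists_mem_barycentreStar y
  exact Finset.sum_pos' (fun s _ => starWeight_nonneg _ y) ⟨⟨s, hs⟩, Finset.mem_univ _,
    (starWeight_nonneg _ y).lt_of_ne' (starWeight_ne_zero_iff.2 hy)⟩

open Classical in
/-- A homotopy inverse of the canonical map from the barycentric subdivision. -/
noncomputable def subdivisionInv (X : FinSimplicialComplex.{u}) :
    C(X.realization, X.barycentricSubdivision.realization) where
  toFun y := ⟨fun s => starWeight (vertexFace s) y /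
      ∑ t : X.barycentricSubdivision.V, starWeight (vertexFace t) y, by
    refine ⟨⟨fun s => div_nonneg (starWeight_nonneg _ y) (sum_starWeight_pos y).le, ?_⟩,
      Finset.univ.filter fun s => y ∈ barycentreStar X (vertexFace s), ?_, fun s hs => ?_⟩
    · rw [← Finset.sum_div, div_self (sum_starWeight_pos y).ne']
    · obtain ⟨s, hs, hy⟩ := exists_mem_barycentreStar y
      refine mem_faces_barycentricSubdivision.2 ⟨⟨⟨s, hs⟩, Finset.mem_filter.2
        ⟨Finset.mem_univ _, hy⟩⟩, fun s hs t ht => ?_⟩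
      exact subset_of_mem_barycentreStar (Finset.mem_filter.1 hs).2 (Finset.mem_filter.1 ht).2
    · refine Finset.mem_filter.2 ⟨Finset.mem_univ _, starWeight_ne_zero_iff.1 fun h => hs ?_⟩
      simp only [h, zero_div]⟩
  continuous_toFun := by
    refine Continuous.subtype_mk (continuous_pi fun s => ?_) _
    exact (continuous_starWeight _).div (continuous_finsetSum _ fun t _ => continuous_starWeight _)
      fun y => (sum_starWeight_pos y).ne'

/-- Going to `X` and back by `subdivisionInv` keeps a point in every simplex of the subdivision that
contains it, so a straight-line homotopy joins the identity to the round trip. -/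
theorem map_subdivisionMap_injective (x : X.barycentricSubdivision.realization) :
    Function.Injective (FundamentalGroup.map (subdivisionMap X) x) := by
  refine map_injective_of_homotopy _ (subdivisionInv X) (straightHomotopy _ _ fun x => ?_) x
  obtain ⟨c, hc, hx⟩ := x.2.2
  refine ⟨c, hc, hx, fun s hs => mem_of_subdivisionMap_mem_barycentreStar hc hx
    (starWeight_ne_zero_iff.1 fun h => hs ?_)⟩
  show starWeight (vertexFace s) (subdivisionMap X x) / _ = 0
  rw [h, zero_div]

/-! ### Mesh of iterated subdivisions -/

section Mesh

variable {E : Type*} [NormedAddCommGroup E] [NormedSpace ℝ E]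

/-- The barycentre of the positions of the vertices of a face. -/
noncomputable def meanPosition (p : X.V → E) (s : X.barycentricSubdivision.V) : E :=
  ((vertexFace s).card : ℝ)⁻¹ • ∑ v ∈ vertexFace s, p v

theorem norm_mean_le {V : Type*} {s : Finset V} (hs : s.Nonempty) (f : V → E) {R : ℝ}
    (h : ∀ v ∈ s, ‖f v‖ ≤ R) : ‖(s.card : ℝ)⁻¹ • ∑ v ∈ s, f v‖ ≤ R := by
  have hc : (0 : ℝ) < s.card := by exact_mod_cast Finset.card_pos.2 hs
  rw [norm_smul, norm_inv, Real.norm_natCast, inv_mul_le_iff₀ hc]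
  simpa using norm_sum_le_of_le s h

theorem mean_sub {V : Type*} {s : Finset V} (hs : s.Nonempty) (f : V → E) (a : E) :
    (s.card : ℝ)⁻¹ • ∑ v ∈ s, f v - a = (s.card : ℝ)⁻¹ • ∑ v ∈ s, (f v - a) := by
  have hc : (s.card : ℝ) ≠ 0 := by exact_mod_cast (Finset.card_pos.2 hs).ne'
  rw [Finset.sum_sub_distrib, Finset.sum_const, smul_sub, ← Nat.cast_smul_eq_nsmul ℝ, smul_smul,
    inv_mul_cancel₀ hc, one_smul]

theorem dist_meanPosition_le {k : ℕ} (hX : X.DimLE k) (p : X.V → E) {D : ℝ}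
    (hp : ∀ s ∈ X.complex.faces, ∀ u ∈ s, ∀ v ∈ s, dist (p u) (p v) ≤ D)
    {c : Finset X.barycentricSubdivision.V} (hc : c ∈ X.barycentricSubdivision.complex.faces)
    {s t : X.barycentricSubdivision.V} (hs : s ∈ c) (ht : t ∈ c) :
    dist (meanPosition p s) (meanPosition p t) ≤ (1 - ((k : ℝ) + 1)⁻¹) * D := by
  classical
  wlog hst : vertexFace s ⊆ vertexFace t generalizing s t
  · rw [dist_comm]
    exact this ht hs (((mem_faces_barycentricSubdivision.1 hc).2 s hs t ht).resolve_left hst)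
  have hsne := face_nonempty (vertexFace_mem s)
  have htne := face_nonempty (vertexFace_mem t)
  have hcard : (0 : ℝ) < (vertexFace t).card := by exact_mod_cast card_vertexFace_pos t
  have hD : 0 ≤ D := by
    obtain ⟨u, hu⟩ := htne
    exact dist_nonneg.trans (hp _ (vertexFace_mem t) u hu u hu)
  rw [dist_eq_norm, meanPosition, mean_sub hsne]
  refine norm_mean_le hsne _ fun u hu => ?_
  -- In the mean over `vertexFace t` of the differences to `p u`, the term of `u` itself vanishes;
  -- this yields the factor below `1`.
  rw [norm_sub_rev, meanPosition, mean_sub htne, norm_smul, norm_inv, Real.norm_natCast,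
    inv_mul_le_iff₀ hcard, ← Finset.sum_erase_add _ _ (hst hu), sub_self, add_zero]
  refine (norm_sum_le_of_le _ fun v hv => ?_ : _ ≤ ∑ v ∈ (vertexFace t).erase u, D).trans ?_
  · rw [← dist_eq_norm]
    exact hp _ (vertexFace_mem t) v (Finset.mem_of_mem_erase hv) u (hst hu)
  · have hk : ((vertexFace t).card : ℝ) ≤ k + 1 := by exact_mod_cast hX _ (vertexFace_mem t)
    have h1 : (vertexFace t).card * ((k : ℝ) + 1)⁻¹ ≤ 1 :=
      mul_inv_le_one_of_le₀ hk (by positivity)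
    rw [Finset.sum_const, Finset.card_erase_of_mem (hst hu), nsmul_eq_mul,
      Nat.cast_sub (card_vertexFace_pos t), Nat.cast_one, ← mul_assoc]
    refine mul_le_mul_of_nonneg_right ?_ hD
    linarith

theorem sum_subdivisionMap_smul (p : X.V → E) (x : X.barycentricSubdivision.realization) :
    ∑ v, (subdivisionMap X x).1 v • p v = ∑ s, x.1 s • meanPosition p s := by
  classical
  simp only [subdivisionMap_apply, Finset.sum_smul, meanPosition]
  rw [Finset.sum_comm]
  refine Finset.sum_congr rfl fun s _ => ?_
  simp only [mul_smul, ← Finset.smul_sum, ite_smul, zero_smul]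
  congr 1
  rw [Finset.smul_sum, Finset.sum_ite_mem, Finset.univ_inter]

end Mesh

/-- There is a map `|Y| → |X|`, injective on `π₁` and affine on simplices, such that the images of
the edges of `Y` have length at most `D`. -/
def HasFineMap (Y X : FinSimplicialComplex.{u}) (D : ℝ) : Prop :=
  ∃ (h : C(Y.realization, X.realization)) (p : Y.V → X.V → ℝ),
    (∀ x, (h x).1 = ∑ v, x.1 v • p v) ∧
    (∀ x, Function.Injective (FundamentalGroup.map h x)) ∧
    ∀ s ∈ Y.complex.faces, ∀ u ∈ s, ∀ v ∈ s, dist (p u) (p v) ≤ D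

theorem hasFineMap_self (X : FinSimplicialComplex.{u}) : HasFineMap X X 1 := by
  classical
  refine ⟨.id _, fun v => Pi.single v 1, fun x => ?_, fun x p q h => ?_, fun s _ u _ v _ => ?_⟩
  · ext w
    simp [Finset.sum_apply, Pi.single_apply]
  · obtain ⟨γ, rfl⟩ := Path.Homotopic.Quotient.mk_surjective p
    obtain ⟨δ, rfl⟩ := Path.Homotopic.Quotient.mk_surjective q
    exact h
  · refine (dist_pi_le_iff zero_le_one).2 fun w => ?_
    simp only [Pi.single_apply, Real.dist_eq]
    split_ifs <;> simp

theorem HasFineMap.barycentricSubdivision {Y : FinSimplicialComplex.{u}} {k : ℕ} (hY : Y.DimLE k)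
    {D : ℝ} (h : HasFineMap Y X D) :
    HasFineMap Y.barycentricSubdivision X ((1 - ((k : ℝ) + 1)⁻¹) * D) := by
  obtain ⟨h, p, hp, hinj, hD⟩ := h
  refine ⟨h.comp (subdivisionMap Y), meanPosition p, fun x => ?_, fun x q r hqr => ?_,
    fun c hc s hs t ht => dist_meanPosition_le hY p hD hc hs ht⟩
  · exact (hp _).trans (sum_subdivisionMap_smul p x)
  · refine map_subdivisionMap_injective x (hinj _ ?_)
    have e : ∀ q : FundamentalGroup Y.barycentricSubdivision.realization x,
        FundamentalGroup.map (h.comp (subdivisionMap Y)) x q =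
          FundamentalGroup.map h _ (FundamentalGroup.map (subdivisionMap Y) x q) := fun q =>
      Path.Homotopic.Quotient.map_comp
    rw [← e, ← e, hqr]

theorem hasFineMap_iterate {k : ℕ} (hX : X.DimLE k) (n : ℕ) :
    (barycentricSubdivision^[n] X).DimLE k ∧
      HasFineMap (barycentricSubdivision^[n] X) X ((1 - ((k : ℝ) + 1)⁻¹) ^ n) := by
  induction n with
  | zero => exact ⟨hX, by simpa using hasFineMap_self X⟩
  | succ n ih =>
    rw [Function.iterate_succ_apply', pow_succ']
    exact ⟨ih.1.barycentricSubdivision, ih.2.barycentricSubdivision ih.1⟩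

theorem exists_hasFineMap (X : FinSimplicialComplex.{u}) {ε : ℝ} (hε : 0 < ε) :
    ∃ n, ∃ D < ε, HasFineMap (barycentricSubdivision^[n] X) X D := by
  -- Any bound on the dimension will do: it only has to give a contraction ratio below `1` common to
  -- all subdivisions.
  have hX : X.DimLE (Fintype.card X.V) := fun s _ => s.card_le_univ.trans (Nat.le_succ _)
  obtain ⟨n, hn⟩ := exists_pow_lt_of_lt_one hε
    (sub_lt_self 1 (by positivity : (0 : ℝ) < ((Fintype.card X.V : ℝ) + 1)⁻¹))
  exact ⟨n, _, hn, (hasFineMap_iterate hX n).2⟩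

/-! ### From a `𝒢`-cover to a simplicial map -/

theorem exists_isOpenGCover_of_cat_le {𝒢 : GroupClass.{u}} {T : Type u}
    [TopologicalSpace T] {k : ℕ} (h : 𝒢.cat T ≤ (k : ℕ∞) + 1) :
    ∃ 𝒰 : Set (Set T), 𝒢.IsOpenGCover 𝒰 ∧ 𝒰.encard ≤ (k : ℕ∞) + 1 := by
  have hlt : 𝒢.cat T < ((k + 2 : ℕ) : ℕ∞) := h.trans_lt (by exact_mod_cast Nat.lt_succ_self _)
  simp only [GroupClass.cat, iInf_lt_iff] at hlt
  obtain ⟨n, ⟨𝒰, h𝒰, hn⟩, hlt⟩ := hlt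
  refine ⟨𝒰, h𝒰, hn.trans_le ?_⟩
  exact_mod_cast Nat.lt_succ_iff.1 (by exact_mod_cast hlt)

/-- The full simplex on a finite set of vertices. -/
def fullSimplex (V : Type u) [Fintype V] : FinSimplicialComplex.{u} where
  V := V
  complex :=
    { faces := {s | s.Nonempty}
      isRelLowerSet_faces := fun _ hs => ⟨hs, fun _ _ ht => ht⟩
      singleton_mem := Finset.singleton_nonempty }

open Classical in
/-- The simplicial map to a full simplex given by a map of vertices. -/
def toFullSimplex (X : FinSimplicialComplex.{u}) {V : Type u} [Fintype V] (φ : X.V → V) :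
    SimplicialMap X (fullSimplex V) where
  toFun := φ
  image_mem _ hs := (face_nonempty hs).image φ

/-- A fibre is closed, and convex in each simplex because `f.realize` is affine there. -/
theorem loopSubgroup_fibre_fg (f : SimplicialMap X P) (p : P.realization) (x : X.realization)
    (hx : x ∈ f.realize ⁻¹' {p}) : (loopSubgroup (f.realize ⁻¹' {p}) x hx).FG := by
  refine loopSubgroup_fg_of_convex (isClosed_singleton.preimage f.continuous_realize)
    (fun a ha b hb h t => Subtype.ext (funext fun w => ?_)) x hx
  have ha : f.realize a = p := ha
  have hb : f.realize b = p := hb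
  rw [f.realize_segment h, ha, hb]
  ring

/-- A subset with finitely generated image on `π₁` is a `𝒢`-set if a `π₁`-injective map sends it
into a `𝒢`-set. -/
theorem isGSet_of_mapsTo {𝒢 : GroupClass.{u}} (h𝒢 : 𝒢.ClosedUnderIso)
    (hfg : 𝒢.ClosedUnderFGSubgroups) {T S : Type u} [TopologicalSpace T] [TopologicalSpace S]
    (h : C(T, S)) (hinj : ∀ x, Function.Injective (FundamentalGroup.map h x)) {K : Set T}
    {U : Set S} (hKU : MapsTo h K U) (hU : 𝒢.IsGSet U)
    (hK : ∀ x (hx : x ∈ K), (loopSubgroup K x hx).FG) : 𝒢.IsGSet K := by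
  rintro ⟨x, hx⟩
  have h1 := hU ⟨h x, hKU hx⟩
  rw [range_map_eq_loopSubgroup] at h1 ⊢
  have hle : (loopSubgroup K x hx).map (FundamentalGroup.map h x) ≤
      loopSubgroup U (h x) (hKU hx) := by
    rintro _ ⟨q, hq, rfl⟩
    exact InSet.map h hKU hq
  -- By injectivity the loops of `K` form a group isomorphic to a subgroup of the loops of `U`, and
  -- finite generation carries over to that subgroup.
  have e₁ := (loopSubgroup K x hx).equivMapOfInjective _ (hinj x)
  have e₂ := Subgroup.subgroupOfEquivOfLe hle
  have e := e₂.trans e₁.symm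
  refine h𝒢 _ _ ⟨e⟩ (hfg _ _ ?_ h1)
  have : Group.FG (loopSubgroup K x hx) := (Group.fg_iff_subgroup_fg _).2 (hK x hx)
  exact (Group.fg_iff_subgroup_fg _).1 (Group.fg_of_surjective (f := e.symm.toMonoidHom)
    e.symm.surjective)

/-- The difference is a convex combination of vectors `p u - p v` with `u` and `v` in a common face.
-/
theorem dist_le_of_mem_openStar {h : C(Y.realization, X.realization)} {p : Y.V → X.V → ℝ}
    (hp : ∀ x, (h x).1 = ∑ v, x.1 v • p v) {D : ℝ}
    (hD : ∀ s ∈ Y.complex.faces, ∀ u ∈ s, ∀ v ∈ s, dist (p u) (p v) ≤ D)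
    {v : Y.V} {x : Y.realization} (hx : x ∈ openStar v) : dist (h x) (h (vertexPoint v)) ≤ D := by
  classical
  obtain ⟨s, hs, hxs⟩ := x.2.2
  have hv : v ∈ s := hxs v (ne_of_gt hx)
  have e : (h (vertexPoint v)).1 = p v := by
    rw [hp, Finset.sum_eq_single v]
    · simp [vertexPoint]
    · intro w _ hw
      simp [vertexPoint, hw]
    · simp
  rw [Subtype.dist_eq, e, hp, dist_eq_norm]
  have e' : ∑ u, x.1 u • p u - p v = ∑ u, x.1 u • (p u - p v) := by
    simp only [smul_sub, Finset.sum_sub_distrib]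
    rw [← Finset.sum_smul, realization_sum, one_smul]
  rw [e']
  calc ‖∑ u, x.1 u • (p u - p v)‖ ≤ ∑ u, x.1 u * D := by
        refine norm_sum_le_of_le _ fun u _ => ?_
        rw [norm_smul, Real.norm_of_nonneg (realization_nonneg x u), ← dist_eq_norm]
        by_cases hu : x.1 u = 0
        · simp [hu]
        · exact mul_le_mul_of_nonneg_left (hD s hs u (hxs u hu) v hv) (realization_nonneg x u)
    _ = D := by rw [← Finset.sum_mul, realization_sum, one_mul]

theorem exists_fca_of_cat_le {𝒢 : GroupClass.{u}} (h𝒢 : 𝒢.ClosedUnderIso)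
    (hfg : 𝒢.ClosedUnderFGSubgroups) (X : FinSimplicialComplex.{u}) {k : ℕ}
    (hcat : 𝒢.cat X.realization ≤ (k : ℕ∞) + 1) :
    ∃ n : ℕ, (barycentricSubdivision^[n] X).FCA 𝒢 k := by
  classical
  obtain ⟨𝒰, ⟨h𝒰, hcov⟩, hcard⟩ := exists_isOpenGCover_of_cat_le hcat
  have hfin : 𝒰.Finite := finite_of_encard_le_coe (k := k + 1) (by exact_mod_cast hcard)
  have : Fintype 𝒰 := hfin.fintype
  obtain ⟨ε, hε, hleb⟩ := lebesgue_number_lemma_of_metric (c := fun U : 𝒰 => U.1)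
    (isCompact_univ (X := X.realization)) (fun U => (h𝒰 U.1 U.2).1)
    (by rw [← sUnion_eq_iUnion, hcov])
  obtain ⟨n, D, hDε, h, p, hp, hinj, hD⟩ := exists_hasFineMap X hε
  choose φ hφ using fun v => hleb (h (vertexPoint v)) (mem_univ _)
  have hstar : ∀ v, MapsTo h (openStar v) (φ v).1 := fun v x hx =>
    hφ v ((dist_le_of_mem_openStar hp hD hx).trans_lt hDε)
  -- Every vertex map into a full simplex is simplicial, so the nerve of the cover is not needed.
  refine ⟨n, fullSimplex 𝒰, toFullSimplex _ φ, fun s _ => ?_, fun y => ?_⟩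
  · have h1 : (Fintype.card 𝒰 : ℕ∞) ≤ ((k + 1 : ℕ) : ℕ∞) := by
      rw [← ENat.card_eq_coe_fintype_card]
      exact_mod_cast hcard
    exact s.card_le_univ.trans (by exact_mod_cast h1)
  · obtain ⟨U, hU⟩ := exists_inv_card_le y
    have hUpos : y.1 U ≠ 0 := by
      have : Nonempty (fullSimplex 𝒰).V := ⟨U⟩
      exact (lt_of_lt_of_le (by positivity) hU).ne'
    -- As `y` has a nonzero coordinate at `U`, each point of the fibre lies in the open star of some
    -- `v` with `φ v = U`.
    refine isGSet_of_mapsTo h𝒢 hfg h hinj (U := Subtype.val (p := (· ∈ 𝒰)) U) (fun x hx => ?_)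
      (h𝒰 _ (Subtype.property (p := (· ∈ 𝒰)) U)).2 (loopSubgroup_fibre_fg _ y)
    have hx : (toFullSimplex _ φ).realize x = y := hx
    rw [← hx, SimplicialMap.realize_apply] at hUpos
    obtain ⟨v, hv, hv0⟩ := Finset.exists_ne_zero_of_sum_ne_zero hUpos
    have e : φ v = U := (Finset.mem_filter.1 hv).2
    exact e ▸ hstar v ((realization_nonneg x v).lt_of_ne' hv0)

end FinSimplicialComplex

end

theorem mainTheorem7 (𝒢 : GroupClass.{u}) (h𝒢 : 𝒢.ClosedUnderIso)
    (X : FinSimplicialComplex.{u}) (k : ℕ) :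
    (X.FCA 𝒢 k → 𝒢.cat X.realization ≤ (k : ℕ∞) + 1) ∧
    (𝒢.ClosedUnderFGSubgroups → 𝒢.cat X.realization ≤ (k : ℕ∞) + 1 →
      ∃ n : ℕ, (FinSimplicialComplex.barycentricSubdivision^[n] X).FCA 𝒢 k) :=
  ⟨FinSimplicialComplex.cat_le_of_fca 𝒢 h𝒢 X k, fun hfg hcat =>
    FinSimplicialComplex.exists_fca_of_cat_le h𝒢 hfg X hcat⟩
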